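/- Let $G$ be an undirected graph with nonempty finite node set $V$, $n=|V|$, and edge weights $c_e\ge 0$; let each node $x\in V$ be assigned a vector in $\mathbb R^d$, also denoted $x$. Fix $c',\Delta,\sigma,\alpha$ with $c',\Delta,\alpha>0$ and put $\pi=\frac{6\alpha}{c'n\Delta}$. For $u\in\mathbb R^d$ the procedure $\mathtt{Matching}(u)$ does the following. 1. Compute $w_x=\langle x,u\rangle$ for all $x\in V$. 2. Sort the nodes by $w_x$ (ties broken arbitrarily); let $A$ be the first $\lceil 2c'n\rceil$ nodes and $B$ the last $\lceil 2c'n\rceil$ nodes. 3. Let $G'$ be the network obtained from $G$ (with capacities $c_e$) by adding new nodes $s,t$ and edges $\{s,x\}$, $x\in A$, and $\{y,t\}$, $y\in B$, each of capacity $\pi$. 4. Compute a maximum $s$-$t$ flow and a minimum $s$-$t$ cut in $G'$. 5. If the capacity of the cut is less than $c'n\pi$, return the cut (the partition of $V$ that it induces) and terminate the oracle. 6. Decompose the flow into paths $(s,p,t)$, where $p$ is a path in $G$ from a node of $A$ to a node of $B$, discarding flow cycles; let $f_p\geq 0$ be the flow on $(s,p,t)$ and let $d_{xy}$ be the sum of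 $f_p$ over the paths $p$ from $x$ to $y$. 7. If $\sum_{x,y}d_{xy}\|x-y\|^2\ge 2\alpha$, return the flows $f_p$ and terminate the oracle. 8. Let $M_{\rm short}=\{(x,y)\in A\times B : d_{xy}>0,\ w_y-w_x\ge\sigma,\ \|x-y\|^2\le\Delta\}$. 9. Return an inclusion-maximal matching $M\subseteq M_{\rm short}$, a matching being a set of edges no two of which share a node. The choices in lines 2, 4, 6 and 9 are arbitrary. If the procedure terminates the oracle (line 5 or 7), we set $\mathtt{Matching}(u)=\varnothing$. A partition $(S,\bar S)$ of $V$ is $c'$-balanced if $\min\{|S|,|\bar S|\}\ge c'n$. (a) Let $0<c'\le\frac12$. For every $u$, if the procedure terminates at line 5 then the returned cut is $c'$-balanced. (b) For every $c\in(0,\frac12)$ there exist constants $c'\in(0,c)$ and $\sigma,\delta,\beta>0$, depending only on $c$, such that the following holds for all $\Delta,\alpha>0$, all $d$, and all $G$ and vectors as above that satisfy $\|x\|^2\le 2$ for all $x\in V$ and $\sum_{\{x,y\}\subseteq V}\|x-y\|^2\ge\frac{an^2}{4}$, where $a=3c-4c^2$. Let the choices in the procedure be made as functions of $u$ such that $|\mathtt{Matching}(u)|$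 and the event that the oracle is terminated are measurable. Then, for a standard Gaussian vector $u$ in $\mathbb R^d$, either (i) $\mathbb E_u|\mathtt{Matching}(u)|\ge\delta n$, or (ii) the procedure terminates the oracle at line 5 or 7 with probability at least $\beta$. -/

import Mathlib

open MeasureTheory ProbabilityTheory

universe u

noncomputable section

namespace OracleMatching

/-! Undirected networks, flows and cuts -/

/-- An undirected graph on `V` with nonnegative edge weights (capacities);
weight `0` means that there is no edge. -/
structure CapGraph (V : Type u) where
  cap : V → V → ℝ
  symm : ∀ x y, cap x y = cap y x
  nonneg : ∀ x y, 0 ≤ cap x y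
  loopless : ∀ x, cap x x = 0

/-- The edges of positive capacity. -/
def CapGraph.toSimpleGraph {V : Type u} (G : CapGraph V) : SimpleGraph V where
  Adj x y := 0 < G.cap x y
  symm := ⟨fun x y h => by rw [G.symm y x]; exact h⟩
  loopless := ⟨fun x h => by rw [G.loopless x] at h; exact lt_irrefl _ h⟩

section Network

variable {N : Type u} [Fintype N] [DecidableEq N]

/-- `f i j` is the net flow from `i` to `j` in the undirected network with capacities `cap`. -/
structure IsFlow (cap : N → N → ℝ) (s t : N) (f : N → N → ℝ) : Prop where
  skew : ∀ i j, f i j = -f j i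
  le_cap : ∀ i j, f i j ≤ cap i j
  conserve : ∀ i, i ≠ s → i ≠ t → ∑ j, f i j = 0

/-- The net amount of flow leaving the source `s`. -/
def flowValue (s : N) (f : N → N → ℝ) : ℝ := ∑ j, f s j

/-- Maximum `s`-`t` flows. -/
def IsMaxFlow (cap : N → N → ℝ) (s t : N) (f : N → N → ℝ) : Prop :=
  IsFlow cap s t f ∧ ∀ g, IsFlow cap s t g → flowValue s g ≤ flowValue s f

/-- An `s`-`t` cut, given by its source side. -/
def IsCut (s t : N) (S : Finset N) : Prop := s ∈ S ∧ t ∉ S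

/-- The total capacity of the edges between `S` and its complement. -/
def cutCapacity (cap : N → N → ℝ) (S : Finset N) : ℝ := ∑ i ∈ S, ∑ j ∈ Sᶜ, cap i j

/-- Minimum `s`-`t` cuts. -/
def IsMinCut (cap : N → N → ℝ) (s t : N) (S : Finset N) : Prop :=
  IsCut s t S ∧ ∀ T, IsCut s t T → cutCapacity cap S ≤ cutCapacity cap T

end Network

/-! The auxiliary network -/

/-- The vertices of `V` together with two new vertices `s` and `t`. -/
abbrev Ext (V : Type u) : Type u := V ⊕ Bool

/-- The new source. -/
abbrev src {V : Type u} : Ext V := Sum.inr false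

/-- The new sink. -/
abbrev snk {V : Type u} : Ext V := Sum.inr true

/-- The capacities of the graph obtained from `G` by adding the edges `{s, x}`, `x ∈ A`, and
`{y, t}`, `y ∈ B`, of capacity `π`. -/
def extCap {V : Type u} [DecidableEq V] (G : CapGraph V) (A B : Finset V) (π : ℝ) :
    Ext V → Ext V → ℝ
  | Sum.inl x, Sum.inl y => G.cap x y
  | Sum.inr false, Sum.inl x => if x ∈ A then π else 0
  | Sum.inl x, Sum.inr false => if x ∈ A then π else 0
  | Sum.inl y, Sum.inr true => if y ∈ B then π else 0
  | Sum.inr true, Sum.inl y => if y ∈ B then π else 0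
  | Sum.inr _, Sum.inr _ => 0

/-! Flow decompositions -/

/-- A simple path `p = (x, …, y)` in `G` (possibly with `x = y`). -/
structure GPath {V : Type u} (G : CapGraph V) where
  first : V
  last : V
  walk : G.toSimpleGraph.Walk first last
  isPath : walk.IsPath

section Decomposition

variable {V : Type u} [Fintype V] [DecidableEq V] {G : CapGraph V}

/-- The amount of path flow starting at `x`, i.e. using the arc `s → x` of the paths
`(s, p, t)`. -/
def flowFrom (fp : GPath G →₀ ℝ) (x : V) : ℝ :=
  fp.sum fun p r => if p.first = x then r else 0

/-- The amount of path flow ending at `y`, i.e. using the arc `y → t` of the paths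
`(s, p, t)`. -/
def flowTo (fp : GPath G →₀ ℝ) (y : V) : ℝ :=
  fp.sum fun p r => if p.last = y then r else 0

open Classical in
/-- The amount of path flow traversing the edge `{x, y}` of `G` from `x` to `y`. -/
def flowThrough (fp : GPath G →₀ ℝ) (x y : V) : ℝ :=
  fp.sum fun p r => if ∃ e ∈ p.walk.darts, e.fst = x ∧ e.snd = y then r else 0

/-- The demand `d x y`: the total flow of the paths that start at `x` and end at `y`. -/
def demand (fp : GPath G →₀ ℝ) (x y : V) : ℝ :=
  fp.sum fun p r => if p.first = x ∧ p.last = y then r else 0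

/-- `fp` is what remains of a flow decomposition of the flow `f` on the auxiliary network after
the flow cycles have been removed: the paths `(s, p, t)`, carrying `fp p ≥ 0` units each, use only
the flow that `f` sends along the arcs, and they carry the whole value of `f`. -/
structure IsFlowDecomposition (A B : Finset V) (f : Ext V → Ext V → ℝ)
    (fp : GPath G →₀ ℝ) : Prop where
  nonneg : ∀ p, 0 ≤ fp p
  ends : ∀ p, fp p ≠ 0 → p.first ∈ A ∧ p.last ∈ B
  le_source : ∀ x, flowFrom fp x ≤ max (f src (Sum.inl x)) 0
  le_edge : ∀ x y, flowThrough fp x y ≤ max (f (Sum.inl x) (Sum.inl y)) 0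
  le_sink : ∀ y, flowTo fp y ≤ max (f (Sum.inl y) snk) 0
  total : (fp.sum fun _ r => r) = flowValue src f

end Decomposition

/-- A set of directed edges no two of which share a node. -/
def IsMatching {V : Type u} (M : Finset (V × V)) : Prop :=
  ∀ e ∈ M, ∀ e' ∈ M, e ≠ e' →
    e.1 ≠ e'.1 ∧ e.1 ≠ e'.2 ∧ e.2 ≠ e'.1 ∧ e.2 ≠ e'.2

/-- The partition `(S, V \ S)` is `c'`-balanced. -/
def IsBalanced {V : Type u} [Fintype V] [DecidableEq V] (c' : ℝ) (S : Finset V) : Prop :=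
  c' * (Fintype.card V : ℝ) ≤ min (S.card : ℝ) (Sᶜ.card : ℝ)

/-! The procedure -/

/-- The capacity `π = 6 α / (c' n Δ)` of the new edges. -/
def newCap (V : Type u) [Fintype V] (c' Δ α : ℝ) : ℝ :=
  6 * α / (c' * (Fintype.card V : ℝ) * Δ)

/-- The number `2 c' n` of nodes in each of `A`, `B`, rounded up. -/
def sideSize (V : Type u) [Fintype V] (c' : ℝ) : ℕ := ⌈2 * c' * (Fintype.card V : ℝ)⌉₊

section Procedure

variable {V : Type u} [Fintype V] [DecidableEq V] {d : ℕ}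

/-- The first `2 c' n` nodes in the given order. -/
def firstNodes (c' : ℝ) (order : Fin (Fintype.card V) ≃ V) : Finset V :=
  Finset.univ.filter fun x => ((order.symm x : Fin _) : ℕ) < sideSize V c'

/-- The last `2 c' n` nodes in the given order. -/
def lastNodes (c' : ℝ) (order : Fin (Fintype.card V) ≃ V) : Finset V :=
  Finset.univ.filter fun x => Fintype.card V ≤ ((order.symm x : Fin _) : ℕ) + sideSize V c'

/-- The set `M_short` of pairs `(x, y) ∈ A × B` with `d x y > 0`, `⟨y, u⟩ - ⟨x, u⟩ ≥ σ` (these two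
conditions define `M_all`) and `‖x - y‖² ≤ Δ`. -/
def shortPairs (G : CapGraph V) (v : V → EuclideanSpace ℝ (Fin d)) (Δ σ : ℝ)
    (u : EuclideanSpace ℝ (Fin d)) (A B : Finset V) (fp : GPath G →₀ ℝ) : Finset (V × V) :=
  by
    classical
    exact (A ×ˢ B).filter fun e =>
      (0 < demand fp e.1 e.2 ∧ σ ≤ inner ℝ (v e.2) u - inner ℝ (v e.1) u) ∧
        ‖v e.1 - v e.2‖ ^ 2 ≤ Δ

/-- An execution of the procedure on the vector `u`, for nodes embedded by `v`: all the choices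
that it makes (order of the nodes, maximum flow, minimum cut, flow decomposition, maximal
matching). The choices of the lines that are not reached are irrelevant. -/
structure MatchingRun (G : CapGraph V) (v : V → EuclideanSpace ℝ (Fin d)) (c' Δ σ α : ℝ)
    (u : EuclideanSpace ℝ (Fin d)) where
  order : Fin (Fintype.card V) ≃ V
  sorted : Monotone fun k => (inner ℝ (v (order k)) u : ℝ)
  flow : Ext V → Ext V → ℝ
  isMaxFlow : IsMaxFlow
    (extCap G (firstNodes c' order) (lastNodes c' order) (newCap V c' Δ α)) src snk flow
  cut : Finset (Ext V)
  isMinCut : IsMinCut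
    (extCap G (firstNodes c' order) (lastNodes c' order) (newCap V c' Δ α)) src snk cut
  pathFlow : GPath G →₀ ℝ
  isDecomposition :
    IsFlowDecomposition (firstNodes c' order) (lastNodes c' order) flow pathFlow
  maxMatching : Finset (V × V)
  isMaximal : Maximal
    (fun M => M ⊆ shortPairs G v Δ σ u (firstNodes c' order) (lastNodes c' order) pathFlow ∧
      IsMatching M) maxMatching

namespace MatchingRun

variable {G : CapGraph V} {v : V → EuclideanSpace ℝ (Fin d)} {c' Δ σ α : ℝ}
  {u : EuclideanSpace ℝ (Fin d)}

/-- The capacity of the minimum cut is less than `c' n π`; the procedure returns the cut and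
terminates the oracle (line 5). -/
def StopsWithCut (r : MatchingRun G v c' Δ σ α u) : Prop :=
  cutCapacity
      (extCap G (firstNodes c' r.order) (lastNodes c' r.order) (newCap V c' Δ α)) r.cut <
    c' * (Fintype.card V : ℝ) * newCap V c' Δ α

/-- The source side of the partition of `V` given by the cut. -/
def cutSide (r : MatchingRun G v c' Δ σ α u) : Finset V :=
  Finset.univ.filter fun x => Sum.inl x ∈ r.cut

/-- Line 5 is passed and the flows satisfy `∑ d x y ‖x - y‖² ≥ 2 α`; the procedure returns the
flows and terminates the oracle (line 7). -/
def StopsWithFlow (r : MatchingRun G v c' Δ σ α u) : Prop :=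
  ¬ r.StopsWithCut ∧
    2 * α ≤ ∑ x, ∑ y, demand r.pathFlow x y * ‖v x - v y‖ ^ 2

/-- The oracle is terminated, at line 5 or at line 7. -/
def StopsOracle (r : MatchingRun G v c' Δ σ α u) : Prop :=
  r.StopsWithCut ∨ r.StopsWithFlow

open Classical in
/-- The matching returned; it is empty if the oracle is terminated. -/
def matching (r : MatchingRun G v c' Δ σ α u) : Finset (V × V) :=
  if r.StopsOracle then ∅ else r.maxMatching

end MatchingRun

end Procedure

end OracleMatching

end

open OracleMatching

/-! For (a), a cut cheaper than `c' n π` severs fewer than `c' n` of the arcs at `s` and fewer than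
`c' n` of those at `t`. So at least `c' n` nodes of `A` stay on the source side and at least `c' n`
nodes of `B` on the sink side.

For (b), a pointwise inequality in `u` is integrated (`MatchingRun.sum_inner_sq_le`,
`sum_norm_sq_le_of_runs`). If some pair in `A × B` has gap below `σ`, all but about `4 c' n`
projections lie in an interval shorter than `σ`, so `∑ (w x - w y)²` is small up to a fourth-moment
term. If every gap is at least `σ`, either the oracle stops or the matching has at least `c' n / 3`
edges (`MatchingRun.card_le_of_gap`). Second moments of the projections give the spread `∑ ‖x -
y‖²`, and fourth moments are bounded because the vectors are. A large spread therefore forces the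
stopping probability or the expected matching size to be large. -/

namespace OracleMatching

/-! ### Max-flow min-cut by augmentation. -/

section MaxFlow
variable {N : Type u} [Fintype N] [DecidableEq N]

/-- Along residual arcs, one can route a unit from `s` to any reachable node. -/
lemma exists_unit_routing {R : N → N → Prop} {s v : N} (hv : Relation.ReflTransGen R s v) :
    ∃ h : N → N → ℝ, (∀ i j, h i j = -h j i) ∧ (∀ i j, 0 < h i j → R i j) ∧
      ∀ i, ∑ j, h i j = (if i = s then 1 else 0) - (if i = v then 1 else 0) := by
  induction hv with
  | refl => exact ⟨fun _ _ => 0, by simp, by simp, by simp⟩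
  | @tail v w _ hvw ih =>
    obtain ⟨h, hskew, hpos, hdiv⟩ := ih
    -- A unit on the arc from `v` to `w` is superposed, with its negative on the reverse arc.
    -- Revisited nodes do no harm, so simple paths are not needed.
    refine ⟨fun i j => h i j + (if i = v then if j = w then 1 else 0 else 0)
      - (if i = w then if j = v then 1 else 0 else 0), ?_, ?_, ?_⟩
    · intro i j
      beta_reduce
      rw [hskew i j]
      split_ifs <;> ring
    · intro i j hij
      by_cases hp : 0 < h i j
      · exact hpos i j hp
      · by_cases h1 : i = v ∧ j = w
        · rw [h1.1, h1.2]; exact hvw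
        · exfalso
          push Not at hp
          have h2 : (if i = v then if j = w then (1 : ℝ) else 0 else 0) = 0 := by
            split_ifs with ha hb
            · exact absurd ⟨ha, hb⟩ h1
            · rfl
            · rfl
          have h3 : (0 : ℝ) ≤ if i = w then if j = v then (1 : ℝ) else 0 else 0 := by
            split_ifs <;> norm_num
          beta_reduce at hij
          rw [h2] at hij
          linarith
    · intro i
      rw [Finset.sum_sub_distrib, Finset.sum_add_distrib, hdiv i]
      have key : ∀ a b : N, ∑ j, (if i = a then if j = b then (1 : ℝ) else 0 else 0) =
          if i = a then 1 else 0 := by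
        intro a b
        split_ifs <;> simp
      rw [key, key]
      ring

/-- Strict slack survives a small perturbation by continuity, arcs with `h i j ≤ 0` allow any
positive step, and there are finitely many arcs. -/
lemma exists_step {N : Type u} [Fintype N] {f h cap : N → N → ℝ} (hle : ∀ i j, f i j ≤ cap i j)
    (hpos : ∀ i j, 0 < h i j → f i j < cap i j) :
    ∃ ε : ℝ, 0 < ε ∧ ∀ i j, f i j + ε * h i j ≤ cap i j := by
  have hev : ∀ i j, ∀ᶠ ε in nhdsWithin (0 : ℝ) (Set.Ioi 0), f i j + ε * h i j ≤ cap i j := by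
    intro i j
    by_cases hh : 0 < h i j
    · have hc : Filter.Tendsto (fun ε : ℝ => f i j + ε * h i j) (nhdsWithin 0 (Set.Ioi 0))
          (nhds (f i j + 0 * h i j)) :=
        (Continuous.tendsto (by fun_prop) 0).mono_left nhdsWithin_le_nhds
      refine (hc.eventually_lt_const (by simpa using hpos i j hh)).mono fun _ => le_of_lt
    · filter_upwards [self_mem_nhdsWithin] with ε hε
      have := mul_nonneg (le_of_lt (Set.mem_Ioi.1 hε)) (neg_nonneg.2 (not_lt.1 hh))
      linarith [hle i j]
  have hall : ∀ᶠ ε in nhdsWithin (0 : ℝ) (Set.Ioi 0), ∀ i j, f i j + ε * h i j ≤ cap i j :=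
    Filter.eventually_all.2 fun i => Filter.eventually_all.2 fun j => hev i j
  obtain ⟨ε, h1, h2⟩ := (hall.and self_mem_nhdsWithin).exists
  exact ⟨ε, h2, h1⟩

/-- The flow across a cut is the value of the flow. -/
lemma IsFlow.sum_cut_eq {cap : N → N → ℝ} {s t : N} {f : N → N → ℝ} (hf : IsFlow cap s t f)
    {S : Finset N} (hS : IsCut s t S) : ∑ i ∈ S, ∑ j ∈ Sᶜ, f i j = flowValue s f := by
  have h1 : ∑ i ∈ S, ∑ j, f i j = flowValue s f :=
    Finset.sum_eq_single_of_mem s hS.1 fun i hi his =>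
      hf.conserve i his fun hit => hS.2 (hit ▸ hi)
  have h2 : ∑ i ∈ S, ∑ j ∈ S, f i j = 0 := by
    have : ∑ i ∈ S, ∑ j ∈ S, f i j = -∑ i ∈ S, ∑ j ∈ S, f i j := by
      conv_lhs => rw [Finset.sum_comm]
      simp_rw [← Finset.sum_neg_distrib, ← hf.skew]
    linarith
  rw [← h1]
  simp_rw [← Finset.sum_add_sum_compl S, Finset.sum_add_distrib]
  rw [h2, zero_add]

/-- Max-flow min-cut: the capacity of a minimum cut is at most the value of a maximum flow. -/
lemma IsMinCut.cutCapacity_le {cap : N → N → ℝ} {s t : N} {f : N → N → ℝ} {S : Finset N}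
    (hst : s ≠ t) (hS : IsMinCut cap s t S) (hf : IsMaxFlow cap s t f) :
    cutCapacity cap S ≤ flowValue s f := by
  classical
  -- `T` is the set of nodes reachable in the residual network. If it contained `t`, the flow could
  -- be augmented.
  let T : Finset N :=
    Finset.univ.filter fun v => Relation.ReflTransGen (fun i j => f i j < cap i j) s v
  have hmem : ∀ v, v ∈ T ↔ Relation.ReflTransGen (fun i j => f i j < cap i j) s v := by
    simp [T]
  have hT : IsCut s t T := by
    refine ⟨(hmem s).2 .refl, fun ht => ?_⟩
    obtain ⟨h, hskew, hpos, hdiv⟩ := exists_unit_routing ((hmem t).1 ht)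
    obtain ⟨ε, hε, hle⟩ := exists_step hf.1.le_cap hpos
    have hg : IsFlow cap s t fun i j => f i j + ε * h i j := by
      refine ⟨fun i j => ?_, hle, fun i his hit => ?_⟩
      · rw [hf.1.skew i j, hskew i j]; ring
      · rw [Finset.sum_add_distrib, ← Finset.mul_sum, hdiv, hf.1.conserve i his hit]
        simp [his, hit]
    have hval := hf.2 _ hg
    simp only [flowValue, Finset.sum_add_distrib, ← Finset.mul_sum, hdiv, hst] at hval
    simp at hval
    linarith
  refine (hS.2 T hT).trans (le_of_eq ?_)
  rw [← hf.1.sum_cut_eq hT]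
  refine Finset.sum_congr rfl fun i hi => Finset.sum_congr rfl fun j hj => ?_
  -- An unsaturated arc leaving `T` would make its head reachable.
  refine le_antisymm (not_lt.1 fun hlt => ?_) (hf.1.le_cap i j)
  exact (Finset.mem_compl.1 hj) ((hmem j).2 (((hmem i).1 hi).tail hlt))

end MaxFlow

/-! ### Moments of Gaussian projections. -/

section GaussianMoments

lemma stdGaussian_map_inner {d : ℕ} (z : EuclideanSpace ℝ (Fin d)) :
    (stdGaussian (EuclideanSpace ℝ (Fin d))).map (fun u => inner ℝ z u) =
      (gaussianReal 0 1).map (fun t => ‖z‖ * t) := by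
  have h := IsGaussian.map_eq_gaussianReal (μ := stdGaussian (EuclideanSpace ℝ (Fin d)))
    (innerSL ℝ z)
  rw [integral_strongDual_stdGaussian, variance_dual_stdGaussian, innerSL_apply_norm,
    Real.toNNReal_of_nonneg (sq_nonneg _)] at h
  rw [gaussianReal_map_const_mul, mul_zero, mul_one]
  exact h

lemma integrable_inner_pow {d : ℕ} (z : EuclideanSpace ℝ (Fin d)) (k : ℕ) :
    Integrable (fun u => (inner ℝ z u : ℝ) ^ k) (stdGaussian (EuclideanSpace ℝ (Fin d))) := by
  have hm := memLp_id_gaussianReal (μ := 0) (v := 1) k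
  have h1 : Integrable (fun t : ℝ => t ^ k) (gaussianReal 0 1) := by
    have := hm.integrable_norm_pow'
    refine this.mono (by fun_prop) (Filter.Eventually.of_forall fun t => by simp)
  have h2 : Integrable (fun t : ℝ => t ^ k) ((gaussianReal 0 1).map (fun t => ‖z‖ * t)) := by
    rw [integrable_map_measure (by fun_prop) (by fun_prop)]
    simpa [Function.comp_def, mul_pow] using h1.const_mul (‖z‖ ^ k)
  rw [← stdGaussian_map_inner, integrable_map_measure (by fun_prop) (by fun_prop)] at h2
  exact h2

lemma integral_inner_pow {d : ℕ} (z : EuclideanSpace ℝ (Fin d)) (k : ℕ) :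
    ∫ u, (inner ℝ z u : ℝ) ^ k ∂(stdGaussian (EuclideanSpace ℝ (Fin d))) =
      ‖z‖ ^ k * ∫ t, t ^ k ∂(gaussianReal 0 1) := by
  have h1 : ∫ t : ℝ, t ^ k ∂((stdGaussian (EuclideanSpace ℝ (Fin d))).map
      (fun u => inner ℝ z u)) = ∫ t : ℝ, t ^ k ∂((gaussianReal 0 1).map (fun t => ‖z‖ * t)) := by
    rw [stdGaussian_map_inner]
  rw [integral_map (by fun_prop) (by fun_prop), integral_map (by fun_prop) (by fun_prop)] at h1
  rw [h1, ← integral_const_mul]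
  simp_rw [mul_pow]

lemma integral_inner_sq {d : ℕ} (z : EuclideanSpace ℝ (Fin d)) :
    ∫ u, (inner ℝ z u : ℝ) ^ 2 ∂(stdGaussian (EuclideanSpace ℝ (Fin d))) = ‖z‖ ^ 2 := by
  have h : ∫ t : ℝ, t ^ 2 ∂(gaussianReal 0 1) = 1 := by
    have := variance_of_integral_eq_zero (μ := gaussianReal 0 1) (X := fun t => t)
      (by fun_prop) integral_id_gaussianReal
    rw [variance_fun_id_gaussianReal] at this
    simpa using this.symm
  rw [integral_inner_pow, h, mul_one]

end GaussianMoments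

/-! ### Sorted projections and the small-gap case. -/

section Order
variable {V : Type u} [Fintype V] [DecidableEq V]

omit [DecidableEq V] in
lemma card_filter_symm {n : ℕ} (e : Fin n ≃ V) (p : Fin n → Prop) [DecidablePred p] :
    (Finset.univ.filter fun x => p (e.symm x)).card = (Finset.univ.filter p).card :=
  Finset.card_equiv e.symm (by simp)

omit [DecidableEq V] in
lemma card_firstNodes {c' : ℝ} (hk : sideSize V c' ≤ Fintype.card V)
    (order : Fin (Fintype.card V) ≃ V) : (firstNodes c' order).card = sideSize V c' := by
  rw [firstNodes, card_filter_symm order fun i : Fin (Fintype.card V) => (i : ℕ) < sideSize V c',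
    Fin.card_filter_val_lt, min_eq_right hk]

omit [DecidableEq V] in
lemma card_lastNodes {c' : ℝ} (hk : sideSize V c' ≤ Fintype.card V)
    (order : Fin (Fintype.card V) ≃ V) : (lastNodes c' order).card = sideSize V c' := by
  rw [← card_firstNodes hk order, firstNodes, lastNodes]
  -- Reversing the order exchanges last and first nodes.
  refine Finset.card_equiv (order.symm.trans (Fin.revPerm.trans order)) fun x => ?_
  simp [Fin.val_rev]
  omega

/-- Complete the square. Fourth moments thus pay for pairs about which nothing else is known. -/
lemma sq_le_mul_pow_four_add {ε : ℝ} (hε : 0 < ε) (t : ℝ) :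
    t ^ 2 ≤ ε * t ^ 4 + 1 / (4 * ε) := by
  have h : ε * t ^ 4 + 1 / (4 * ε) - t ^ 2 = ε * (t ^ 2 - 1 / (2 * ε)) ^ 2 := by
    field_simp
    ring
  have h0 : 0 ≤ ε * (t ^ 2 - 1 / (2 * ε)) ^ 2 := by positivity
  linarith

/-- If the first and the last nodes are not separated by a gap `σ`, then all but few nodes lie
in a short interval. -/
lemma sum_sq_le_of_small_gap {w : V → ℝ} {c' σ ε : ℝ} (hc' : 0 < c') (hε : 0 < ε)
    {order : Fin (Fintype.card V) ≃ V} (hw : Monotone fun k => w (order k)) {x y : V}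
    (hx : x ∈ firstNodes c' order) (hy : y ∈ lastNodes c' order) (hxy : w y - w x < σ) :
    ∑ a, ∑ b, (w a - w b) ^ 2 ≤ ε * (∑ a, ∑ b, (w a - w b) ^ 4) +
      σ ^ 2 * (Fintype.card V : ℝ) ^ 2 + 2 * c' * (Fintype.card V : ℝ) ^ 2 / ε := by
  set i := order.symm x with hi
  set j := order.symm y with hj
  have hxi : x = order i := by simp [hi]
  have hyj : y = order j := by simp [hj]
  simp only [firstNodes, lastNodes, Finset.mem_filter, Finset.mem_univ, true_and] at hx hy
  let out : Finset V := Finset.univ.filter fun z => order.symm z < i ∨ j < order.symm z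
  have hout : (out.card : ℝ) ≤ 4 * c' * Fintype.card V := by
    have h1 : out.card ≤ (i : ℕ) + (Fintype.card V - 1 - j) := by
      have h2 : out = (Finset.univ.filter fun z => order.symm z < i) ∪
          Finset.univ.filter fun z => j < order.symm z := by
        rw [← Finset.filter_or]
      rw [h2]
      refine (Finset.card_union_le _ _).trans (le_of_eq ?_)
      rw [card_filter_symm order fun a => a < i, card_filter_symm order fun a => j < a]
      rw [Finset.filter_gt_eq_Iio, Finset.filter_lt_eq_Ioi, Fin.card_Iio, Fin.card_Ioi]
    have hpos : 0 ≤ 2 * c' * (Fintype.card V : ℝ) := by positivity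
    have hk : (sideSize V c' : ℝ) < 2 * c' * Fintype.card V + 1 := Nat.ceil_lt_add_one hpos
    -- At most `sideSize V c' - 1` nodes lie on each side, also when `j < i`. The `2` saved absorbs
    -- the rounding in `sideSize`.
    have h3 : out.card + 2 ≤ 2 * sideSize V c' := by
      have := j.isLt
      omega
    have h4 : (out.card : ℝ) + 2 ≤ 2 * sideSize V c' := by exact_mod_cast h3
    linarith
  -- Pairs inside the interval cost `σ ^ 2`; the others are charged `1 / (4 * ε)` per outlying
  -- endpoint.
  have hterm : ∀ a b, (w a - w b) ^ 2 ≤ ε * (w a - w b) ^ 4 + σ ^ 2 +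
      ((if a ∈ out then 1 / (4 * ε) else 0) + if b ∈ out then 1 / (4 * ε) else 0) := by
    intro a b
    have h4 : 0 ≤ ε * (w a - w b) ^ 4 := by positivity
    have hinv : 0 < 1 / (4 * ε) := by positivity
    by_cases hab : a ∈ out ∨ b ∈ out
    · have hs : 1 / (4 * ε) ≤
          (if a ∈ out then 1 / (4 * ε) else 0) + if b ∈ out then 1 / (4 * ε) else 0 := by
        rcases hab with h | h
        · rw [if_pos h]
          split_ifs <;> linarith
        · rw [if_pos h]
          split_ifs <;> linarith
      have ham := sq_le_mul_pow_four_add hε (w a - w b)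
      linarith [sq_nonneg σ]
    · push Not at hab
      have hin : ∀ z, z ∉ out → w x ≤ w z ∧ w z ≤ w y := by
        intro z hz
        simp only [out, Finset.mem_filter, Finset.mem_univ, true_and, not_or, not_lt] at hz
        have h1 := hw hz.1
        have h2 := hw hz.2
        simp only [Equiv.apply_symm_apply] at h1 h2
        rw [hxi, hyj]
        exact ⟨h1, h2⟩
      obtain ⟨a1, a2⟩ := hin a hab.1
      obtain ⟨b1, b2⟩ := hin b hab.2
      have : (w a - w b) ^ 2 ≤ σ ^ 2 := sq_le_sq' (by linarith) (by linarith)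
      rw [if_neg hab.1, if_neg hab.2]
      linarith
  calc ∑ a, ∑ b, (w a - w b) ^ 2
      ≤ ∑ a, ∑ b, (ε * (w a - w b) ^ 4 + σ ^ 2 +
        ((if a ∈ out then 1 / (4 * ε) else 0) + if b ∈ out then 1 / (4 * ε) else 0)) :=
        Finset.sum_le_sum fun a _ => Finset.sum_le_sum fun b _ => hterm a b
    _ = ε * (∑ a, ∑ b, (w a - w b) ^ 4) + σ ^ 2 * (Fintype.card V : ℝ) ^ 2 + out.card * Fintype.card V / (2 * ε) := by
        simp only [Finset.sum_add_distrib, ← Finset.mul_sum, Finset.sum_const, Finset.card_univ,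
          nsmul_eq_mul, Finset.sum_ite_mem, Finset.univ_inter]
        field_simp
        ring
    _ ≤ _ := by
        gcongr _ + _ + ?_
        rw [div_le_div_iff₀ (by positivity) hε]
        have : 0 ≤ (Fintype.card V : ℝ) * ε := by positivity
        nlinarith [mul_le_mul_of_nonneg_right hout this]

end Order

/-! ### Balance of cheap cuts. -/

section Cut
variable {V : Type u} [Fintype V] [DecidableEq V]

omit [Fintype V] in
lemma extCap_nonneg (G : CapGraph V) (A B : Finset V) {π : ℝ} (hπ : 0 ≤ π) (i j : Ext V) :
    0 ≤ extCap G A B π i j := by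
  rcases i with x | _ | _ <;> rcases j with y | _ | _ <;> simp only [extCap] <;>
    first | exact G.nonneg _ _ | (split_ifs <;> simp [hπ]) | exact le_rfl

/-- Each node of `A` on the sink side has its arc from `s` cut. The next lemma is the mirror image
at `t`. -/
lemma card_diff_mul_le_cutCapacity (G : CapGraph V) (A B : Finset V) {π : ℝ} (hπ : 0 ≤ π)
    {S : Finset (Ext V)} (hS : IsCut src snk S) :
    ((A.filter fun x => Sum.inl x ∉ S).card : ℝ) * π ≤ cutCapacity (extCap G A B π) S := by
  calc ((A.filter fun x => Sum.inl x ∉ S).card : ℝ) * π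
      = ∑ j ∈ (A.filter fun x => Sum.inl x ∉ S).map Function.Embedding.inl,
          extCap G A B π src j := by
        rw [Finset.sum_map, Finset.sum_congr rfl (g := fun _ => π)]
        · simp
        · intro x hx
          simp [extCap, (Finset.mem_filter.1 hx).1]
    _ ≤ ∑ j ∈ Sᶜ, extCap G A B π src j := by
        refine Finset.sum_le_sum_of_subset_of_nonneg ?_ fun j _ _ => extCap_nonneg G A B hπ _ j
        intro j hj
        simp only [Finset.mem_map, Finset.mem_filter] at hj
        obtain ⟨x, hx, rfl⟩ := hj
        simpa using hx.2
    _ ≤ _ := Finset.single_le_sum (f := fun i => ∑ j ∈ Sᶜ, extCap G A B π i j)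
        (fun i _ => Finset.sum_nonneg fun j _ => extCap_nonneg G A B hπ i j) hS.1

lemma card_inter_mul_le_cutCapacity (G : CapGraph V) (A B : Finset V) {π : ℝ} (hπ : 0 ≤ π)
    {S : Finset (Ext V)} (hS : IsCut src snk S) :
    ((B.filter fun x => Sum.inl x ∈ S).card : ℝ) * π ≤ cutCapacity (extCap G A B π) S := by
  calc ((B.filter fun x => Sum.inl x ∈ S).card : ℝ) * π
      = ∑ j ∈ (B.filter fun x => Sum.inl x ∈ S).map Function.Embedding.inl,
          extCap G A B π j snk := by
        rw [Finset.sum_map, Finset.sum_congr rfl (g := fun _ => π)]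
        · simp
        · intro x hx
          simp [extCap, (Finset.mem_filter.1 hx).1]
    _ ≤ ∑ i ∈ S, extCap G A B π i snk := by
        refine Finset.sum_le_sum_of_subset_of_nonneg ?_ fun j _ _ => extCap_nonneg G A B hπ j _
        intro j hj
        simp only [Finset.mem_map, Finset.mem_filter] at hj
        obtain ⟨x, hx, rfl⟩ := hj
        exact hx.2
    _ ≤ _ := Finset.sum_le_sum fun i _ => Finset.single_le_sum
        (fun j _ => extCap_nonneg G A B hπ i j) (Finset.mem_compl.2 hS.2)

omit [DecidableEq V] in
lemma newCap_pos [Nonempty V] {c' Δ α : ℝ} (hc' : 0 < c') (hΔ : 0 < Δ) (hα : 0 < α) :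
    0 < newCap V c' Δ α := by
  have : 0 < (Fintype.card V : ℝ) := by exact_mod_cast Fintype.card_pos
  unfold newCap
  positivity

theorem MatchingRun.StopsWithCut.isBalanced [Nonempty V] {d : ℕ} {G : CapGraph V}
    {v : V → EuclideanSpace ℝ (Fin d)} {c' Δ σ α : ℝ} (hc' : 0 < c') (hc2 : c' ≤ 1 / 2)
    (hΔ : 0 < Δ) (hα : 0 < α) {u : EuclideanSpace ℝ (Fin d)} {r : MatchingRun G v c' Δ σ α u}
    (hr : r.StopsWithCut) : IsBalanced c' r.cutSide := by
  have hπ := newCap_pos (V := V) hc' hΔ hα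
  have hn : 0 < (Fintype.card V : ℝ) := by exact_mod_cast Fintype.card_pos
  -- This is where `c' ≤ 1 / 2` enters: `A` and `B` then really have `sideSize V c'` nodes.
  have hk : sideSize V c' ≤ Fintype.card V := by
    refine Nat.ceil_le.2 ?_
    nlinarith
  have hk' : 2 * c' * (Fintype.card V : ℝ) ≤ sideSize V c' := Nat.le_ceil _
  set A := firstNodes c' r.order with hA
  set B := lastNodes c' r.order with hB
  have h1 := (card_diff_mul_le_cutCapacity G A B hπ.le r.isMinCut.1).trans_lt hr
  have h2 := (card_inter_mul_le_cutCapacity G A B hπ.le r.isMinCut.1).trans_lt hr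
  have h1 := lt_of_mul_lt_mul_right h1 hπ.le
  have h2 := lt_of_mul_lt_mul_right h2 hπ.le
  have hAc := Finset.card_filter_add_card_filter_not (s := A) fun x => Sum.inl x ∈ r.cut
  have hBc := Finset.card_filter_add_card_filter_not (s := B) fun x => Sum.inl x ∈ r.cut
  rw [hA, card_firstNodes hk, ← hA] at hAc
  rw [hB, card_lastNodes hk, ← hB] at hBc
  have hAs : (A.filter fun x => Sum.inl x ∈ r.cut).card ≤ r.cutSide.card :=
    Finset.card_le_card fun x hx => by
      simpa [MatchingRun.cutSide] using (Finset.mem_filter.1 hx).2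
  have hBs : (B.filter fun x => Sum.inl x ∉ r.cut).card ≤ r.cutSideᶜ.card :=
    Finset.card_le_card fun x hx => by
      simpa [MatchingRun.cutSide] using (Finset.mem_filter.1 hx).2
  rify at hAc hBc hAs hBs
  exact le_min (by linarith) (by linarith)

end Cut

/-! ### Path flows and maximal matchings. -/

section Flow
variable {V : Type u} [Fintype V] [DecidableEq V] {G : CapGraph V}

lemma sum_demand_mul (fp : GPath G →₀ ℝ) (D : V → V → ℝ) :
    ∑ x, ∑ y, demand fp x y * D x y = ∑ p ∈ fp.support, fp p * D p.first p.last := by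
  simp only [demand, Finsupp.sum, Finset.sum_mul]
  simp_rw [fun x => Finset.sum_comm (s := Finset.univ) (t := fp.support)
    (f := fun y p => (if GPath.first p = x ∧ p.last = y then fp p else 0) * D x y)]
  rw [Finset.sum_comm]
  refine Finset.sum_congr rfl fun p _ => ?_
  rw [Finset.sum_eq_single p.first, Finset.sum_eq_single p.last]
  · simp
  · intro y _ hy
    simp [hy.symm]
  · simp
  · intro x _ hx
    simp [hx.symm]
  · simp

omit [Fintype V] in
lemma demand_pos {fp : GPath G →₀ ℝ} (hfp : ∀ p, 0 ≤ fp p) {p : GPath G} (hp : p ∈ fp.support) :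
    0 < demand fp p.first p.last := by
  have hpos : 0 < fp p := lt_of_le_of_ne (hfp p) (Finsupp.mem_support_iff.1 hp).symm
  refine Finset.sum_pos' (fun q _ => ?_) ⟨p, hp, by simpa using hpos⟩
  dsimp only
  split_ifs
  · exact hfp q
  · exact le_rfl

omit [Fintype V] in
/-- A maximal matching between disjoint sides touches every edge. -/
lemma exists_mem_touching {A B : Finset V} (hAB : Disjoint A B) {E M : Finset (V × V)}
    (hE : E ⊆ A ×ˢ B) (hM : Maximal (fun M => M ⊆ E ∧ IsMatching M) M) {e : V × V} (he : e ∈ E) :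
    ∃ m ∈ M, e.1 = m.1 ∨ e.2 = m.2 := by
  by_contra! hcon
  have hne : ∀ a ∈ E, ∀ b ∈ E, a.1 ≠ b.2 := fun a ha b hb =>
    (Finset.disjoint_iff_ne.1 hAB) _ (Finset.mem_product.1 (hE ha)).1 _
      (Finset.mem_product.1 (hE hb)).2
  have hins : insert e M ⊆ E ∧ IsMatching (insert e M) := by
    refine ⟨Finset.insert_subset he hM.prop.1, fun a ha b hb hab => ?_⟩
    have haE := Finset.insert_subset he hM.prop.1 ha
    have hbE := Finset.insert_subset he hM.prop.1 hb
    have h : a.1 ≠ b.1 ∧ a.2 ≠ b.2 := by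
      rcases Finset.mem_insert.1 ha with rfl | ha' <;> rcases Finset.mem_insert.1 hb with rfl | hb'
      · exact absurd rfl hab
      · exact hcon b hb'
      · exact ⟨(hcon a ha').1.symm, (hcon a ha').2.symm⟩
      · exact ⟨(hM.prop.2 a ha' b hb' hab).1, (hM.prop.2 a ha' b hb' hab).2.2.2⟩
    exact ⟨h.1, hne a haE b hbE, (hne b hbE a haE).symm, h.2⟩
  have hmem := hM.le_of_ge hins (Finset.subset_insert e M) (Finset.mem_insert_self e M)
  exact (hcon e hmem).1 rfl

/-- If `A` and `B` are separated by a gap `σ` and the oracle is not terminated, then the matching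
is large. -/
lemma MatchingRun.card_le_of_gap [Nonempty V] {d : ℕ}
    {v : V → EuclideanSpace ℝ (Fin d)} {c' Δ σ α : ℝ} (hc' : 0 < c') (hσ : 0 < σ)
    (hΔ : 0 < Δ) (hα : 0 < α) {u : EuclideanSpace ℝ (Fin d)} (r : MatchingRun G v c' Δ σ α u)
    (hgap : ∀ x ∈ firstNodes c' r.order, ∀ y ∈ lastNodes c' r.order,
      σ ≤ inner ℝ (v y) u - inner ℝ (v x) u) (hr : ¬ r.StopsOracle) :
    c' * (Fintype.card V : ℝ) ≤ 3 * (r.matching.card : ℝ) := by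
  have hmat : r.matching = r.maxMatching := if_neg hr
  rw [hmat]
  simp only [MatchingRun.StopsOracle, not_or, MatchingRun.StopsWithFlow, not_and, not_le] at hr
  obtain ⟨hcut, hflow⟩ := hr
  have hflow := hflow hcut
  set A := firstNodes c' r.order with hA
  set B := lastNodes c' r.order with hB
  set M := r.maxMatching with hM
  set fp := r.pathFlow with hfp
  set π := newCap V c' Δ α with hπdef
  have hπ : 0 < π := newCap_pos hc' hΔ hα
  have hn : 0 < (Fintype.card V : ℝ) := by exact_mod_cast Fintype.card_pos
  -- The capacity `π` is chosen so that passing the cut test guarantees flow value `6 * α / Δ`.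
  have hcn : c' * (Fintype.card V : ℝ) * π = 6 * α / Δ := by
    rw [hπdef, newCap]
    field_simp
  have hdec := r.isDecomposition
  have htotal : 6 * α / Δ ≤ ∑ p ∈ fp.support, fp p := by
    have h1 := r.isMinCut.cutCapacity_le (by simp) r.isMaxFlow
    rw [← hdec.total, Finsupp.sum] at h1
    rw [← hcn]
    exact (not_lt.1 hcut).trans h1
  rw [sum_demand_mul fp fun x y => ‖v x - v y‖ ^ 2] at hflow
  have hAB : Disjoint A B := Finset.disjoint_left.2 fun x hxA hxB => by
    have := hgap x hxA x hxB
    linarith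
  let short := fp.support.filter fun p => ‖v p.first - v p.last‖ ^ 2 ≤ Δ
  let long := fp.support.filter fun p => ¬ ‖v p.first - v p.last‖ ^ 2 ≤ Δ
  have hsplit : ∑ p ∈ short, fp p + ∑ p ∈ long, fp p = ∑ p ∈ fp.support, fp p :=
    Finset.sum_filter_add_sum_filter_not _ _ _
  -- Markov's inequality: each unit on a long path contributes at least `Δ` to a sum below `2 * α`.
  have hlong : Δ * ∑ p ∈ long, fp p ≤ 2 * α := by
    refine le_trans ?_ hflow.le
    rw [Finset.mul_sum]
    calc ∑ p ∈ long, Δ * fp p ≤ ∑ p ∈ long, fp p * ‖v p.first - v p.last‖ ^ 2 :=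
          Finset.sum_le_sum fun p hp => by
            rw [mul_comm]
            exact mul_le_mul_of_nonneg_left (not_le.1 (Finset.mem_filter.1 hp).2).le
              (hdec.nonneg p)
      _ ≤ _ := Finset.sum_le_sum_of_subset_of_nonneg (Finset.filter_subset _ _)
            fun p _ _ => mul_nonneg (hdec.nonneg p) (sq_nonneg _)
  have hshort : 4 * α / Δ ≤ ∑ p ∈ short, fp p := by
    have h1 : ∑ p ∈ long, fp p ≤ 2 * α / Δ := by
      rw [le_div_iff₀ hΔ, mul_comm]
      exact hlong
    have h2 : 6 * α / Δ = 4 * α / Δ + 2 * α / Δ := by ring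
    linarith
  have htouch : ∀ p ∈ short, ∃ m ∈ M, p.first = m.1 ∨ p.last = m.2 := by
    intro p hp
    obtain ⟨hps, hpd⟩ := Finset.mem_filter.1 hp
    obtain ⟨hpA, hpB⟩ := hdec.ends p (Finsupp.mem_support_iff.1 hps)
    have he : (p.first, p.last) ∈ shortPairs G v Δ σ u A B fp := by
      simp only [shortPairs, Finset.mem_filter, Finset.mem_product]
      exact ⟨⟨hpA, hpB⟩, ⟨demand_pos hdec.nonneg hps, hgap _ hpA _ hpB⟩, hpd⟩
    refine exists_mem_touching hAB (fun e he => ?_) r.isMaximal he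
    simp only [shortPairs, Finset.mem_filter] at he
    exact he.1
  have hfrom : ∀ x, flowFrom fp x ≤ π := by
    intro x
    refine (hdec.le_source x).trans (max_le ((r.isMaxFlow.1.le_cap _ _).trans ?_) hπ.le)
    simp only [extCap]
    split_ifs
    · exact le_rfl
    · exact hπ.le
  have hto : ∀ y, flowTo fp y ≤ π := by
    intro y
    refine (hdec.le_sink y).trans (max_le ((r.isMaxFlow.1.le_cap _ _).trans ?_) hπ.le)
    simp only [extCap]
    split_ifs
    · exact le_rfl
    · exact hπ.le
  -- Each short path shares its first or last node with a matching edge, and each of these two ends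
  -- carries at most `π`.
  have hupper : ∑ p ∈ short, fp p ≤ M.card * (2 * π) := by
    have hnn : ∀ (m : V × V) (p : GPath G), 0 ≤ (if p.first = m.1 then fp p else 0) +
        if p.last = m.2 then fp p else 0 := fun m p =>
      add_nonneg (by split_ifs; exacts [hdec.nonneg p, le_rfl])
        (by split_ifs; exacts [hdec.nonneg p, le_rfl])
    calc ∑ p ∈ short, fp p
        ≤ ∑ p ∈ short, ∑ m ∈ M, ((if p.first = m.1 then fp p else 0) +
            if p.last = m.2 then fp p else 0) := by
          refine Finset.sum_le_sum fun p hp => ?_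
          obtain ⟨m, hm, h⟩ := htouch p hp
          refine le_trans ?_ (Finset.single_le_sum (fun m _ => hnn m p) hm)
          have := hdec.nonneg p
          rcases h with h | h
          · rw [if_pos h]
            split_ifs <;> linarith
          · rw [if_pos h]
            split_ifs <;> linarith
      _ ≤ ∑ p ∈ fp.support, ∑ m ∈ M, ((if p.first = m.1 then fp p else 0) +
            if p.last = m.2 then fp p else 0) :=
          Finset.sum_le_sum_of_subset_of_nonneg (Finset.filter_subset _ _)
            fun p _ _ => Finset.sum_nonneg fun m _ => hnn m p
      _ = ∑ m ∈ M, (flowFrom fp m.1 + flowTo fp m.2) := by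
          rw [Finset.sum_comm]
          simp only [Finset.sum_add_distrib, flowFrom, flowTo, Finsupp.sum]
      _ ≤ ∑ m ∈ M, 2 * π := Finset.sum_le_sum fun m _ => by
          linarith [hfrom m.1, hto m.2]
      _ = _ := by simp
  -- Short paths carry `4 * α / Δ`, two thirds of `c' n π`, so `2 π |M|` is at least that much.
  have h1 : 2 * (c' * (Fintype.card V : ℝ) * π) ≤ 3 * (M.card * (2 * π)) := by
    rw [hcn]
    have : 4 * α / Δ * 3 = 2 * (6 * α / Δ) := by ring
    linarith
  nlinarith [le_of_mul_le_mul_right (a := π) (b := c' * (Fintype.card V : ℝ))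
    (c := 3 * (M.card : ℝ)) (by linarith) hπ]

end Flow

/-! ### The pointwise inequality and its expectation. -/

section Main
variable {V : Type u} [Fintype V] [DecidableEq V] [Nonempty V] {d : ℕ} {G : CapGraph V}
  {v : V → EuclideanSpace ℝ (Fin d)} {c' Δ σ α : ℝ}

-- The last bracket acts as an indicator of the large-gap case: there it is at least `1`, and the
-- crude bound `n² / (4 ε)` applies. With a small gap, the other terms suffice.
open Classical in
lemma MatchingRun.sum_inner_sq_le {ε : ℝ} (hc' : 0 < c') (hσ : 0 < σ) (hΔ : 0 < Δ) (hα : 0 < α)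
    (hε : 0 < ε) {u : EuclideanSpace ℝ (Fin d)} (r : MatchingRun G v c' Δ σ α u) :
    ∑ x, ∑ y, (inner ℝ (v x - v y) u : ℝ) ^ 2 ≤
      ε * (∑ x, ∑ y, (inner ℝ (v x - v y) u : ℝ) ^ 4) +
        (σ ^ 2 * (Fintype.card V : ℝ) ^ 2 + 2 * c' * (Fintype.card V : ℝ) ^ 2 / ε) +
        (Fintype.card V : ℝ) ^ 2 / (4 * ε) * ((if r.StopsOracle then 1 else 0) +
          3 / (c' * (Fintype.card V : ℝ)) * r.matching.card) := by
  have hn : 0 < (Fintype.card V : ℝ) := by exact_mod_cast Fintype.card_pos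
  simp only [inner_sub_left]
  by_cases hgap : ∀ x ∈ firstNodes c' r.order, ∀ y ∈ lastNodes c' r.order,
      σ ≤ inner ℝ (v y) u - inner ℝ (v x) u
  · have h1 : 1 ≤ (if r.StopsOracle then (1 : ℝ) else 0) +
        3 / (c' * (Fintype.card V : ℝ)) * r.matching.card := by
      by_cases hr : r.StopsOracle
      · rw [if_pos hr]
        have : 0 ≤ 3 / (c' * (Fintype.card V : ℝ)) * r.matching.card := by positivity
        linarith
      · rw [if_neg hr, zero_add, div_mul_eq_mul_div, le_div_iff₀ (by positivity), one_mul]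
        exact r.card_le_of_gap hc' hσ hΔ hα hgap hr
    have h2 : ∑ x, ∑ y, (inner ℝ (v x) u - inner ℝ (v y) u : ℝ) ^ 2 ≤
        ε * (∑ x, ∑ y, (inner ℝ (v x) u - inner ℝ (v y) u : ℝ) ^ 4) +
          (Fintype.card V : ℝ) ^ 2 / (4 * ε) := by
      calc ∑ x, ∑ y, (inner ℝ (v x) u - inner ℝ (v y) u : ℝ) ^ 2
          ≤ ∑ x, ∑ y, (ε * (inner ℝ (v x) u - inner ℝ (v y) u : ℝ) ^ 4 + 1 / (4 * ε)) := by
            refine Finset.sum_le_sum fun x _ => Finset.sum_le_sum fun y _ => ?_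
            exact sq_le_mul_pow_four_add hε _
        _ = _ := by
            simp only [Finset.sum_add_distrib, ← Finset.mul_sum, Finset.sum_const,
              Finset.card_univ, nsmul_eq_mul]
            ring
    have h3 : 0 ≤ (Fintype.card V : ℝ) ^ 2 / (4 * ε) := by positivity
    have h4 : 0 ≤ σ ^ 2 * (Fintype.card V : ℝ) ^ 2 + 2 * c' * (Fintype.card V : ℝ) ^ 2 / ε := by
      positivity
    linarith [le_mul_of_one_le_right h3 h1]
  · push Not at hgap
    obtain ⟨x, hx, y, hy, hxy⟩ := hgap
    have h := sum_sq_le_of_small_gap (w := fun x => inner ℝ (v x) u) hc' hε r.sorted hx hy hxy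
    have h0 : 0 ≤ (Fintype.card V : ℝ) ^ 2 / (4 * ε) * ((if r.StopsOracle then 1 else 0) +
        3 / (c' * (Fintype.card V : ℝ)) * r.matching.card) := by
      have : (0 : ℝ) ≤ if r.StopsOracle then 1 else 0 := by split_ifs <;> norm_num
      positivity
    linarith

/-- Expectation of the pointwise inequality, using that `inner ℝ z u` is distributed as `‖z‖` times
a standard normal. -/
lemma sum_norm_sq_le_of_runs {ε : ℝ} (hc' : 0 < c') (hσ : 0 < σ) (hΔ : 0 < Δ) (hα : 0 < α)
    (hε : 0 < ε) (run : (u : EuclideanSpace ℝ (Fin d)) → MatchingRun G v c' Δ σ α u)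
    (hmeas : MeasurableSet {u | (run u).StopsOracle})
    (hcard : Measurable fun u => (run u).matching.card) :
    ∑ x, ∑ y, ‖v x - v y‖ ^ 2 ≤
      ε * ((∑ x, ∑ y, ‖v x - v y‖ ^ 4) * ∫ t, t ^ 4 ∂(gaussianReal 0 1)) +
        (σ ^ 2 * (Fintype.card V : ℝ) ^ 2 + 2 * c' * (Fintype.card V : ℝ) ^ 2 / ε) +
        (Fintype.card V : ℝ) ^ 2 / (4 * ε) *
          ((stdGaussian (EuclideanSpace ℝ (Fin d))).real {u | (run u).StopsOracle} +
          3 / (c' * (Fintype.card V : ℝ)) *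
            ∫ u, ((run u).matching.card : ℝ) ∂(stdGaussian (EuclideanSpace ℝ (Fin d)))) := by
  classical
  set μ := stdGaussian (EuclideanSpace ℝ (Fin d)) with hμ
  have hintM : Integrable (fun u => ((run u).matching.card : ℝ)) μ := by
    refine Integrable.of_bound (C := Fintype.card (V × V))
      (measurable_from_top.comp hcard).aestronglyMeasurable
      (Filter.Eventually.of_forall fun u => ?_)
    rw [Real.norm_natCast]
    exact_mod_cast Finset.card_le_univ (run u).matching
  have hite : (fun u => if (run u).StopsOracle then (1 : ℝ) else 0) =
      {u | (run u).StopsOracle}.indicator 1 := by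
    ext u
    simp [Set.indicator_apply]
  have hintS : Integrable (fun u => if (run u).StopsOracle then (1 : ℝ) else 0) μ := by
    rw [hite]
    exact (integrable_const (1 : ℝ)).indicator hmeas
  have hS : ∫ u, (if (run u).StopsOracle then (1 : ℝ) else 0) ∂μ =
      μ.real {u | (run u).StopsOracle} := by
    rw [hite, integral_indicator_one hmeas]
  have hpow : ∀ k : ℕ, Integrable
      (fun u => ∑ x, ∑ y, (inner ℝ (v x - v y) u : ℝ) ^ k) μ := fun k =>
    integrable_finsetSum _ fun x _ => integrable_finsetSum _ fun y _ => integrable_inner_pow _ k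
  have hint : ∀ k : ℕ, ∫ u, ∑ x, ∑ y, (inner ℝ (v x - v y) u : ℝ) ^ k ∂μ =
      ∑ x, ∑ y, ∫ u, (inner ℝ (v x - v y) u : ℝ) ^ k ∂μ := by
    intro k
    rw [integral_finsetSum _ fun x _ =>
      integrable_finsetSum _ fun y _ => integrable_inner_pow _ k]
    exact Finset.sum_congr rfl fun x _ =>
      integral_finsetSum _ fun y _ => integrable_inner_pow _ k
  have h := integral_mono (μ := μ) (hpow 2)
    ((((hpow 4).const_mul ε).add (integrable_const _)).add
      ((hintS.add (hintM.const_mul _)).const_mul _))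
    fun u => (run u).sum_inner_sq_le hc' hσ hΔ hα hε
  rw [integral_add' (((hpow 4).const_mul ε).add (integrable_const _))
      ((hintS.add (hintM.const_mul _)).const_mul _),
    integral_add' ((hpow 4).const_mul ε) (integrable_const _)] at h
  simp only [Pi.add_apply] at h
  rw [integral_const_mul, integral_const_mul, integral_add hintS (hintM.const_mul _),
    integral_const_mul, hS, hint 2, hint 4] at h
  simp_rw [hμ, integral_inner_sq, integral_inner_pow] at h
  simpa [← Finset.sum_mul] using h

end Main

end OracleMatching

/-! ### Choice of constants and conclusion. -/

open OracleMatching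
theorem mainTheorem8 :
    (∀ (V : Type u) [Fintype V] [DecidableEq V] [Nonempty V] (d : ℕ)
        (G : CapGraph V) (v : V → EuclideanSpace ℝ (Fin d)) (c' Δ σ α : ℝ),
        0 < c' → c' ≤ 1 / 2 → 0 < Δ → 0 < α →
        ∀ (u : EuclideanSpace ℝ (Fin d)) (r : MatchingRun G v c' Δ σ α u),
          r.StopsWithCut → IsBalanced c' r.cutSide) ∧
    (∀ c : ℝ, 0 < c → c < 1 / 2 →
      ∃ c' σ δ β : ℝ, 0 < c' ∧ c' < c ∧ 0 < σ ∧ 0 < δ ∧ 0 < β ∧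
        ∀ (V : Type u) [Fintype V] [DecidableEq V] [Nonempty V] (d : ℕ)
          (G : CapGraph V) (v : V → EuclideanSpace ℝ (Fin d)),
          (∀ x, ‖v x‖ ^ 2 ≤ 2) →
          (3 * c - 4 * c ^ 2) * (Fintype.card V : ℝ) ^ 2 / 4 ≤
            (∑ x, ∑ y, ‖v x - v y‖ ^ 2) / 2 →
          ∀ Δ α : ℝ, 0 < Δ → 0 < α →
          ∀ run : (u : EuclideanSpace ℝ (Fin d)) → MatchingRun G v c' Δ σ α u,
            MeasurableSet {u | (run u).StopsOracle} →
            Measurable (fun u => (run u).matching.card) →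
            δ * (Fintype.card V : ℝ) ≤
                ∫ u, ((run u).matching.card : ℝ) ∂(stdGaussian (EuclideanSpace ℝ (Fin d))) ∨
              β ≤ (stdGaussian (EuclideanSpace ℝ (Fin d))).real {u | (run u).StopsOracle}) := by
  refine ⟨fun V _ _ _ d G v c' Δ σ α hc' hc2 hΔ hα u r hr => hr.isBalanced hc' hc2 hΔ hα,
    fun c hc hc2 => ?_⟩
  set a : ℝ := 3 * c - 4 * c ^ 2 with ha
  have hapos : 0 < a := by
    rw [ha]
    nlinarith
  -- Only finiteness and sign of the fourth moment matter. The `+ 1` in `ε` keeps the denominator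
  -- positive.
  obtain ⟨K, hK, hK0⟩ : ∃ K : ℝ, K = ∫ t, t ^ 4 ∂(gaussianReal 0 1) ∧ 0 ≤ K :=
    ⟨_, rfl, integral_nonneg fun t => by positivity⟩
  obtain ⟨ε, hε⟩ : ∃ ε : ℝ, ε = a / (8 * (64 * K + 1)) := ⟨_, rfl⟩
  have hεpos : 0 < ε := by
    rw [hε]
    positivity
  have hεK : ε * (64 * K) ≤ a / 8 := by
    rw [hε, div_mul_eq_mul_div, div_le_div_iff₀ (by positivity) (by norm_num)]
    nlinarith
  obtain ⟨c', hc'pos, hc'c, hc'ε⟩ : ∃ c' : ℝ, 0 < c' ∧ c' < c ∧ c' ≤ a * ε / 16 :=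
    ⟨min (c / 2) (a * ε / 16), by positivity, (min_le_left _ _).trans_lt (by linarith),
      min_le_right _ _⟩
  -- `σ` makes the interval term `a / 8 * n ^ 2`. `δ` and `β` each contribute `ε * a / 4` to the
  -- bracket, which is then weighted by `n ^ 2 / (4 * ε)`.
  refine ⟨c', √(a / 8), c' * (ε * a) / 12, ε * a / 4, hc'pos, hc'c, by positivity, by positivity,
    by positivity, fun V _ _ _ d G v hv hsum Δ α hΔ hα run hmeas hcard => ?_⟩
  have hn : 0 < (Fintype.card V : ℝ) := by exact_mod_cast Fintype.card_pos
  have h := sum_norm_sq_le_of_runs hc'pos (Real.sqrt_pos.2 (by positivity)) hΔ hα hεpos run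
    hmeas hcard
  rw [← hK, Real.sq_sqrt (by positivity)] at h
  set P := (stdGaussian (EuclideanSpace ℝ (Fin d))).real {u | (run u).StopsOracle}
  set E := ∫ u, ((run u).matching.card : ℝ) ∂(stdGaussian (EuclideanSpace ℝ (Fin d)))
  set n := (Fintype.card V : ℝ)
  have hfour : ∑ x, ∑ y, ‖v x - v y‖ ^ 4 ≤ 64 * n ^ 2 := by
    have hb : ∀ x y, ‖v x - v y‖ ^ 4 ≤ 64 := by
      intro x y
      have h1 : ‖v x - v y‖ ^ 2 ≤ 8 := by
        have := parallelogram_law_with_norm ℝ (v x) (v y)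
        nlinarith [hv x, hv y, sq_nonneg ‖v x + v y‖]
      calc ‖v x - v y‖ ^ 4 = (‖v x - v y‖ ^ 2) ^ 2 := by ring
        _ ≤ 8 ^ 2 := by gcongr
        _ = 64 := by norm_num
    calc ∑ x, ∑ y, ‖v x - v y‖ ^ 4 ≤ ∑ _x : V, ∑ _y : V, (64 : ℝ) :=
          Finset.sum_le_sum fun x _ => Finset.sum_le_sum fun y _ => hb x y
      _ = 64 * n ^ 2 := by
          simp only [Finset.sum_const, Finset.card_univ, nsmul_eq_mul]
          ring
  -- Over ordered pairs the spread is at least `a / 2 * n ^ 2`, while the upper bound consists of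
  -- four terms of at most `a / 8 * n ^ 2`, the last one strictly smaller.
  by_contra! hcon
  obtain ⟨hE, hP⟩ := hcon
  have h1 : ε * ((∑ x, ∑ y, ‖v x - v y‖ ^ 4) * K) ≤ a / 8 * n ^ 2 := by
    calc ε * ((∑ x, ∑ y, ‖v x - v y‖ ^ 4) * K) ≤ ε * (64 * n ^ 2 * K) := by gcongr
      _ = ε * (64 * K) * n ^ 2 := by ring
      _ ≤ _ := by gcongr
  have h2 : 2 * c' * n ^ 2 / ε ≤ a / 8 * n ^ 2 := by
    rw [div_le_iff₀ hεpos]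
    nlinarith [mul_le_mul_of_nonneg_right hc'ε (sq_nonneg n)]
  have h3 : 3 / (c' * n) * E < ε * a / 4 := by
    rw [div_mul_eq_mul_div, div_lt_iff₀ (by positivity)]
    linarith
  have h4 : n ^ 2 / (4 * ε) * (P + 3 / (c' * n) * E) < a / 8 * n ^ 2 := by
    have h5 : P + 3 / (c' * n) * E < ε * a / 2 := by linarith
    calc n ^ 2 / (4 * ε) * (P + 3 / (c' * n) * E) < n ^ 2 / (4 * ε) * (ε * a / 2) := by gcongr
      _ = _ := by
        field_simp
        ring
  linarith
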